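/- Let $E: y^2+a_1xy+a_3y=x^3+a_2x^2+a_4x+a_6$ be an elliptic curve over $\mathbb{Q}$, with the usual quantities $b_2=a_1^2+4a_2$, $c_4$, $c_6$. Let $N\ge 1$ and let $f$ be a cusp form of weight $2$ for $\Gamma_0(N)$. For $\tau$ in the upper half plane $\mathcal{H}$ put $$\gamma(\tau)=\int_{i\infty}^{\tau}2\pi i f(z)\,dz .$$ Assume that the set of periods $L=\{\gamma(M\tau)-\gamma(\tau): M\in\Gamma_0(N),\ \tau\in\mathcal{H}\}$ is the period lattice of $E$, that is, $L$ is a lattice in $\mathbb{C}$ with $g_2(L)=c_4/12$ and $g_3(L)=c_6/216$. (This holds in particular when $N$ is the conductor of $E$, $f$ is the normalized newform associated to $E$, and $E$, given by a global minimal equation, is optimal with Manin constant $1$; then $[\tau]\mapsto(x(\tau),y(\tau))$ is the modular parametrization $X_0(N)\to E$, with $x$ as below.) Let $\wp$ be the Weierstrass function of $L$ and let $$x(\tau)=\wp(\gamma(\tau))-\frac{b_2}{12}\in\mathbb{C}\cup\{\infty\}\qquad(\tau\in\mathcal{H}),$$ with $x(\tau)=\infty$ exactly when $\gamma(\tau)\in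 L$. Let $j$ be the modular invariant. Let $F_N(x,j)=\sum_k A_k(j)x^k\in\mathbb{Z}[j][x]$ be the minimal polynomial of the function $x$ over $\mathbb{C}(j)$, normalized to have coefficients $A_k(j)\in\mathbb{Z}[j]$ without a common factor in $\mathbb{Z}[j]$ other than $\pm1$; that is, $F_N$ is irreducible in $\mathbb{C}(j)[x]$, its coefficients $A_k$ have no common factor in $\mathbb{Z}[j]$ other than $\pm1$, and $F_N(x(\tau),j(\tau))=0$ for all $\tau\in\mathcal{H}$ with $x(\tau)\neq\infty$. If $\alpha,\beta\in\mathbb{C}$ satisfy $F_N(\alpha,\beta)=0$, then there exists $\tau\in\mathcal{H}$ such that $x(\tau)=\alpha$ and $j(\tau)=\beta$. -/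

import Mathlib

open Polynomial UpperHalfPlane

noncomputable section

namespace ModularParam

/-- Weight `2` cusp forms for `Γ₀(N)`. -/
abbrev CuspFormTwo (N : ℕ) : Type :=
  CuspForm ((CongruenceSubgroup.Gamma0 N).map (Matrix.SpecialLinearGroup.mapGL ℝ)) 2

/-- The modular invariant `j = E₄³ / Δ = q⁻¹ + 744 + ⋯`, with `E₄ = 1 + 240 q + ⋯`
and `Δ = η²⁴ = q - 24 q² + ⋯`. -/
def jInv (τ : ℍ) : ℂ := ModularForm.E₄ τ ^ 3 / ModularForm.discriminant τ

/-- The Eichler integral `γ(τ) = ∫_{i∞}^τ 2πi f(z) dz`, taken along the vertical line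
`z = Re τ + i t`, `dz = i dt`, with `t` going from `∞` down to `Im τ`. -/
def eichler {N : ℕ} (f : CuspFormTwo N) (τ : ℍ) : ℂ :=
  -∫ t in Set.Ioi τ.im,
    2 * Real.pi * Complex.I * f (ofComplex (τ.re + t * Complex.I)) * Complex.I

/-- The set `{γ(Mτ) - γ(τ) : M ∈ Γ₀(N)}` of periods of `2πi f(z) dz`. -/
def periods {N : ℕ} (f : CuspFormTwo N) : Set ℂ :=
  {w | ∃ M ∈ CongruenceSubgroup.Gamma0 N, ∃ τ : ℍ, w = eichler f (M • τ) - eichler f τ}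

/-- `Λ` is the period lattice of the Weierstrass curve `E` with respect to its invariant
differential `dx / (2y + a₁x + a₃)`: with `X = x + b₂/12` and `Y = 2y + a₁x + a₃` the equation
of `E` becomes `Y² = 4X³ - (c₄/12) X - c₆/216`, and this has to be
`Y² = 4X³ - g₂(Λ) X - g₃(Λ)`. -/
structure IsPeriodLattice (E : WeierstrassCurve ℚ) (Λ : PeriodPair) : Prop where
  g₂_eq : Λ.g₂ = (E.c₄ : ℂ) / 12
  g₃_eq : Λ.g₃ = (E.c₆ : ℂ) / 216

open Classical in
/-- The function `x(τ) = ℘(γ(τ)) - b₂/12` on `ℋ` with values in `ℂ ∪ {∞}`, where `℘` is the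
Weierstrass function of `Λ`; its value is `∞` exactly when `γ(τ) ∈ Λ`. -/
def xFun (E : WeierstrassCurve ℚ) (Λ : PeriodPair) {N : ℕ} (f : CuspFormTwo N) (τ : ℍ) :
    OnePoint ℂ :=
  if eichler f τ ∈ Λ.lattice then OnePoint.infty
  else ((Λ.weierstrassP (eichler f τ) - (E.b₂ : ℂ) / 12 : ℂ) : OnePoint ℂ)

/-- The value `F(α, β) ∈ ℂ` of `F = ∑ₖ Aₖ(j) xᵏ ∈ ℤ[j][x]` at `x = α`, `j = β`. (The inner
variable of `F` is `j`, the outer one is `x`.) -/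
def evalXJ (F : ℤ[X][X]) (α β : ℂ) : ℂ :=
  F.eval₂ (aeval β : ℤ[X] →ₐ[ℤ] ℂ).toRingHom α

/-- The inclusion `ℤ[j] → ℂ(j)`. -/
def intPolyToRatFunc : ℤ[X] →+* RatFunc ℂ :=
  (algebraMap ℂ[X] (RatFunc ℂ)).comp (mapRingHom (Int.castRingHom ℂ))

/-- `F ∈ ℤ[j][x]` is (up to sign, the) modular polynomial relating the function `x` on `ℋ`
to `j`: up to a factor in `ℂ(j)` it is the minimal polynomial of `x` over `ℂ(j)`, and its
coefficients `Aₖ(j) ∈ ℤ[j]` have no common factor except `±1`. -/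
structure IsModularPolynomial (x : ℍ → OnePoint ℂ) (F : ℤ[X][X]) : Prop where
  /-- `F(x, j) = 0` as meromorphic functions on `ℋ` -/
  vanishes : ∀ (τ : ℍ) (a : ℂ), x τ = (a : OnePoint ℂ) → evalXJ F a (jInv τ) = 0
  /-- `F` is irreducible in `ℂ(j)[x]` -/
  irreducible : Irreducible (F.map intPolyToRatFunc)
  /-- no common factor of the coefficients in `ℤ[j]`, constant or not -/
  primitive : F.IsPrimitive

end ModularParam

end

noncomputable section

namespace ModularParam

open ModularForm Filter Topology MatrixGroups Function.Periodic
open scoped Manifold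

local notation "Δ" => ModularForm.discriminant

/-! ### Level one modular functions are polynomials in `j` -/

/-! Integrality of `1/(x - α)` over `ℂ[j]`, away from the other zeros of `F(α, j)`, excludes a
missing point. Suppose no `τ` over `j = β` has `x(τ) = α`. If `F(α, j)` vanished identically, `x`
would be constantly `α`, contradicting surjectivity of `j`; so `F(α, j) = (j - β)^m a(j)` with `a(β)
≠ 0`. Put `z = a(j)/(x - α)`. Over `j = β` it is locally bounded by assumption; elsewhere the
relation `F(x, j) = 0`, expanded around `x = α`, bounds `(j - β)^m z` in terms of `j` alone. Hence
`z` extends holomorphically to `ℋ`, and since the bound is invariant under `SL(2, ℤ)`, it controls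
`z` at all cusps at once. The product of `X - z ∘ g⁻¹` over the cosets of `Γ₀(N)` has level one
coefficients, which are polynomials in `j`, so `z` is a root of a monic `R` over `ℂ[j]`
(`exists_integral_extension`).

Multiplying `R(a/(X - α))` by `(X - α)^n`, `n = deg R`, gives a polynomial vanishing at `(x, j)`,
hence divisible by `F` over `ℂ[j]` (`IsModularPolynomial.dvd_of_frequently`). At `(α, β)` it equals
`a(β)^n ≠ 0`, whereas `F(α, β) = 0`. -/

lemma tendsto_atImInfty_coeff_zero {k : ℤ} (f : ModularForm 𝒮ℒ k) :
    Tendsto f atImInfty (𝓝 ((qExpansion 1 f).coeff 0)) := by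
  have h1 := ModularFormClass.analyticAt_cuspFunction_zero f one_pos one_mem_strictPeriods_SL
  have hper := SlashInvariantFormClass.periodic_comp_ofComplex f one_mem_strictPeriods_SL
  rw [qExpansion_coeff_zero one_pos h1 hper, ← cuspFunction_apply_zero one_pos h1 hper]
  exact (h1.continuousAt.tendsto.comp (qParam_tendsto_atImInfty one_pos)).congr fun τ ↦
    SlashInvariantFormClass.eq_cuspFunction f τ one_mem_strictPeriods_SL one_ne_zero

lemma tendsto_E₄_atImInfty : Tendsto (E₄ : ℍ → ℂ) atImInfty (𝓝 1) := by
  simpa [EisensteinSeries.E_qExpansion_coeff_zero (k := 4) (by norm_num) (by decide)] using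
    tendsto_atImInfty_coeff_zero E₄

lemma discriminant_holo : MDiff (discriminant : ℍ → ℂ) := CuspForm.discriminant.holo'

lemma jInv_mul_discriminant (τ : ℍ) : jInv τ * Δ τ = E₄ τ ^ 3 :=
  div_mul_cancel₀ _ (discriminant_ne_zero τ)

lemma mdifferentiable_jInv : MDiff jInv :=
  (E₄.holo'.pow 3).div discriminant_holo discriminant_ne_zero

lemma levelOne_smul {F : Type*} [FunLike F ℍ ℂ] {k : ℤ} [SlashInvariantFormClass F 𝒮ℒ k]
    (f : F) (g : SL(2, ℤ)) (τ : ℍ) : f (g • τ) = denom g τ ^ k * f τ := by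
  exact SlashInvariantForm.slash_action_eqn'' (Γ := 𝒮ℒ) f (MonoidHom.mem_range.mpr ⟨g, rfl⟩) τ

lemma jInv_smul (g : SL(2, ℤ)) (τ : ℍ) : jInv (g • τ) = jInv τ := by
  have h1 := levelOne_smul E₄ g τ
  have h2 := levelOne_smul CuspForm.discriminant g τ
  rw [CuspForm.coe_discriminant] at h2
  have h3 := denom_ne_zero g τ
  have h4 := discriminant_ne_zero τ
  rw [jInv, jInv, h1, h2]
  field_simp

lemma tendsto_norm_jInv_atTop : Tendsto (fun τ ↦ ‖jInv τ‖) atImInfty atTop := by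
  have h1 : Tendsto (fun τ ↦ ‖E₄ τ ^ 3‖) atImInfty (𝓝 1) := by
    simpa using (tendsto_E₄_atImInfty.pow 3).norm
  have h2 : Tendsto (fun τ ↦ ‖Δ τ‖) atImInfty (𝓝[>] 0) := by
    refine tendsto_nhdsWithin_iff.mpr ⟨?_, .of_forall fun τ ↦ by simp [discriminant_ne_zero τ]⟩
    simpa using (discriminant_isZeroAtImInfty : Tendsto _ _ _).norm
  simpa [jInv, div_eq_mul_inv] using h1.pos_mul_atTop one_pos h2.inv_tendsto_nhdsGT_zero

lemma polynomial_eq_zero_of_eventually {p : ℂ[X]} (h : ∀ᶠ τ in atImInfty, p.eval (jInv τ) = 0) :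
    p = 0 := by
  by_contra hp
  have hb : ∃ B : ℝ, ∀ z, p.eval z = 0 → ‖z‖ < B := by
    obtain ⟨B, hB⟩ := (p.roots.toFinset.finite_toSet.image norm).bddAbove
    refine ⟨B + 1, fun z hz ↦ ?_⟩
    have : ‖z‖ ≤ B := hB ⟨z, by simp [hp, hz], rfl⟩
    linarith
  obtain ⟨B, hB⟩ := hb
  obtain ⟨τ, h1, h2⟩ := (h.and (tendsto_norm_jInv_atTop.eventually_ge_atTop B)).exists
  exact (hB _ h1).not_ge h2

/-- Subtracting a multiple of `E₄^(3(m+1))` removes the constant term; the remaining cusp form is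
divisible by `Δ`, which lowers the weight by 12, and `E₄³ = jΔ`. -/
lemma exists_polynomial_of_modularForm (m : ℕ) (f : ModularForm 𝒮ℒ (12 * m)) :
    ∃ p : ℂ[X], ∀ τ, f τ = p.eval (jInv τ) * Δ τ ^ m := by
  induction m with
  | zero =>
    obtain ⟨c, hc⟩ := ModularFormClass.levelOne_weight_zero_const (F := ModularForm 𝒮ℒ 0)
      (f.mcast (by simp))
    exact ⟨C c, fun τ ↦ by simpa using congrFun hc τ⟩
  | succ m ih =>
    set e : ModularForm 𝒮ℒ (12 * (m + 1 : ℕ)) :=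
      ModularForm.mcast (by push_cast; ring) (E₄.pow (3 * (m + 1))) with he
    have he1 : (qExpansion 1 e).coeff 0 = 1 := by
      rw [he, ModularForm.qExpansion_mcast, ModularForm.qExpansion_pow one_pos
        one_mem_strictPeriods_SL, PowerSeries.coeff_zero_eq_constantCoeff_apply, map_pow,
        ← PowerSeries.coeff_zero_eq_constantCoeff_apply,
        EisensteinSeries.E_qExpansion_coeff_zero (k := 4) (by norm_num) (by decide), one_pow]
    obtain ⟨g, hg⟩ := ModularForm.sub_smul_isCuspForm f e he1
    set c := (qExpansion 1 f).coeff 0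
    obtain ⟨p, hp⟩ := ih ((CuspForm.discriminantEquiv g).mcast (by push_cast; ring))
    refine ⟨p + C c * X ^ (m + 1), fun τ ↦ ?_⟩
    have h1 : g τ = f τ - c * E₄ τ ^ (3 * (m + 1)) := by
      have h0 : (E₄.pow (3 * (m + 1))) τ = E₄ τ ^ (3 * (m + 1)) := by
        rw [ModularForm.coe_pow, Pi.pow_apply]
      rw [← h0]
      exact DFunLike.congr_fun hg τ
    have h2 := discriminant_mul_discriminantEquiv_apply g τ
    have h3 : CuspForm.discriminantEquiv g τ = p.eval (jInv τ) * Δ τ ^ m := hp τ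
    rw [h3, h1, pow_mul, ← jInv_mul_discriminant] at h2
    simp only [eval_add, eval_mul, eval_C, eval_pow, eval_X]
    linear_combination -h2

lemma exists_polynomial_jInv {h : ℍ → ℂ} (hd : MDiff h)
    (hinv : ∀ (g : SL(2, ℤ)) τ, h (g • τ) = h τ)
    {m : ℕ} (hb : IsBoundedAtImInfty fun τ ↦ h τ * Δ τ ^ m) :
    ∃ p : ℂ[X], ∀ τ, h τ = p.eval (jInv τ) := by
  have hs (g : SL(2, ℤ)) : (fun τ ↦ h τ * Δ τ ^ m) ∣[(12 * m : ℤ)] g = fun τ ↦ h τ * Δ τ ^ m := by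
    ext τ
    have h2 := levelOne_smul CuspForm.discriminant g τ
    rw [CuspForm.coe_discriminant] at h2
    have h3 := denom_ne_zero g τ
    rw [SL_slash_apply, hinv, h2, mul_pow, ← zpow_natCast, ← zpow_mul, zpow_neg]
    field_simp
  obtain ⟨p, hp⟩ := exists_polynomial_of_modularForm m
    { toFun := fun τ ↦ h τ * Δ τ ^ m
      slash_action_eq' := fun _ ⟨g, hg⟩ ↦ hg ▸ hs g
      holo' := hd.mul (discriminant_holo.pow m)
      bdd_at_cusps' := fun {c} hc ↦ by
        rw [Subgroup.IsArithmetic.isCusp_iff_isCusp_SL2Z] at hc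
        rw [OnePoint.isBoundedAt_iff_forall_SL2Z hc]
        intro g _
        rwa [hs g] }
  exact ⟨p, fun τ ↦ mul_right_cancel₀ (pow_ne_zero m (discriminant_ne_zero τ)) (hp τ)⟩

/-- If `β` were omitted, `1/(j - β)` would be of level one, holomorphic and zero at `i∞`, hence a
polynomial in `j`; but `X - β` has no polynomial inverse. -/
lemma jInv_surjective : Function.Surjective jInv := by
  intro β
  by_contra! hβ
  have hne (τ : ℍ) : jInv τ - β ≠ 0 := sub_ne_zero.mpr (hβ τ)
  have hd : MDiff fun τ ↦ (jInv τ - β)⁻¹ := by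
    convert! (mdifferentiable_const (I := 𝓘(ℂ)) (c := (1 : ℂ))).div
      (mdifferentiable_jInv.sub (mdifferentiable_const (c := β))) hne using 1
    ext τ
    simp
  have hb : IsBoundedAtImInfty fun τ ↦ (jInv τ - β)⁻¹ * Δ τ ^ 0 := by
    simp only [pow_zero, mul_one]
    refine ZeroAtFilter.boundedAtFilter ((tendsto_inv₀_cobounded (α := ℂ)).comp ?_)
    rw [← tendsto_norm_atTop_iff_cobounded]
    exact tendsto_atTop_mono (fun τ ↦ norm_sub_norm_le _ _)
      (tendsto_atTop_add_const_right _ _ tendsto_norm_jInv_atTop)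
  obtain ⟨p, hp⟩ := exists_polynomial_jInv hd (fun g τ ↦ by rw [jInv_smul]) hb
  have : p * (X - C β) - 1 = 0 := polynomial_eq_zero_of_eventually <| .of_forall fun τ ↦ by
    simp [← hp τ, hne τ]
  simpa using congrArg (eval β) this

/-! ### The Eichler integral and the function `x` -/

/-- In the coordinate `q` the form `2πi f dz` is `φ(q)/q dq`, and `φ(0) = 0` by cuspidality. So the
integrand is holomorphic on the whole disc and has a primitive there, `q = 0` being the endpoint
`i∞`. -/
lemma eichler_eq_primitive {N : ℕ} (f : CuspFormTwo N) :
    ∃ G : ℂ → ℂ, DifferentiableOn ℂ G (Metric.ball 0 1) ∧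
      ∀ τ : ℍ, eichler f τ = G (qParam 1 τ) - G 0 := by
  have hper : (1 : ℝ) ∈ ((CongruenceSubgroup.Gamma0 N).map
      (Matrix.SpecialLinearGroup.mapGL ℝ)).strictPeriods := by simp
  set φ := UpperHalfPlane.cuspFunction 1 f with hφ
  have hφ0 : φ 0 = 0 := CuspFormClass.cuspFunction_apply_zero f one_pos hper
  have hφd : DifferentiableOn ℂ φ (Metric.ball 0 1) := fun q hq ↦
    (ModularFormClass.differentiableAt_cuspFunction f one_pos hper
      (by simpa using hq)).differentiableWithinAt
  have hφτ (τ : ℍ) : φ (qParam 1 τ) = f τ :=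
    SlashInvariantFormClass.eq_cuspFunction f τ hper one_ne_zero
  set ψ := dslope φ 0
  have hψd : DifferentiableOn ℂ ψ (Metric.ball 0 1) :=
    (Complex.differentiableOn_dslope (Metric.ball_mem_nhds 0 one_pos)).mpr hφd
  have hψ (q : ℂ) (hq : q ≠ 0) : ψ q * q = φ q := by
    rw [show ψ q = slope φ 0 q from dslope_of_ne φ hq, slope_def_field, hφ0]
    field_simp
    simp
  obtain ⟨G, hG⟩ := hψd.isExactOn_ball
  refine ⟨G, fun q hq ↦ (hG q hq).differentiableAt.differentiableWithinAt, fun τ ↦ ?_⟩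
  set c : ℝ → ℂ := fun t ↦ qParam 1 (τ.re + t * Complex.I) with hc
  have hcn (t : ℝ) : ‖c t‖ = Real.exp (-(2 * Real.pi) * t) := by
    simp [hc, norm_qParam]
  have hcball {t : ℝ} (ht : 0 < t) : c t ∈ Metric.ball (0 : ℂ) 1 := by
    simpa [hcn] using by positivity
  have hcd (t : ℝ) : HasDerivAt c (c t * (2 * Real.pi * Complex.I * Complex.I)) t := by
    have h1 : HasDerivAt (fun t : ℝ ↦ 2 * Real.pi * Complex.I * (τ.re + t * Complex.I) / (1 : ℝ))
        (2 * Real.pi * Complex.I * Complex.I) t := by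
      have := ((((Complex.ofRealCLM.hasDerivAt (x := t)).mul_const Complex.I).const_add
        (τ.re : ℂ)).const_mul (2 * Real.pi * Complex.I)).div_const ((1 : ℝ) : ℂ)
      simpa [mul_assoc] using this
    exact h1.cexp
  have hc0 : Tendsto c atTop (𝓝 0) := by
    rw [tendsto_zero_iff_norm_tendsto_zero]
    simp only [hcn]
    exact Real.tendsto_exp_atBot.comp
      (tendsto_id.const_mul_atTop_of_neg (by simp [Real.pi_pos]))
  have hfc (t : ℝ) (ht : 0 < t) :
      2 * Real.pi * Complex.I * f (ofComplex (τ.re + t * Complex.I)) * Complex.I =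
        ψ (c t) * (c t * (2 * Real.pi * Complex.I * Complex.I)) := by
    have h2 : f (ofComplex (τ.re + t * Complex.I)) = φ (c t) := by
      rw [← hφτ, ofComplex_apply_of_im_pos (by simpa using ht)]
    rw [h2, ← hψ _ (qParam_ne_zero _)]
    ring
  have h0 : (0 : ℂ) ∈ Metric.ball (0 : ℂ) 1 := by simp
  have hcc : Continuous c := continuous_iff_continuousAt.mpr fun t ↦ (hcd t).continuousAt
  -- `ψ` stays bounded along the path because `c t → 0`, while `c t` itself decays exponentially.
  have hint : MeasureTheory.IntegrableOn
      (fun t : ℝ ↦ ψ (c t) * (c t * (2 * Real.pi * Complex.I * Complex.I))) (Set.Ioi τ.im) := by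
    have h1 : ContinuousOn (fun t : ℝ ↦ ψ (c t) * (c t * (2 * Real.pi * Complex.I * Complex.I)))
        (Set.Ici τ.im) :=
      (hψd.continuousOn.comp hcc.continuousOn fun t ht ↦ hcball (τ.im_pos.trans_le ht)).mul
        (hcc.mul continuous_const).continuousOn
    have h2 : (fun t ↦ ψ (c t)) =O[atTop] fun _ ↦ (1 : ℝ) :=
      ((hψd.differentiableAt (Metric.ball_mem_nhds 0 one_pos)).continuousAt.tendsto.comp
        hc0).isBigO_one ℝ
    have h3 : (fun t ↦ c t * (2 * Real.pi * Complex.I * Complex.I)) =O[atTop]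
        fun t ↦ Real.exp (-(2 * Real.pi) * t) := by
      refine (Asymptotics.isBigO_const_mul_self (2 * Real.pi * Complex.I * Complex.I) c _).congr_left
        (fun _ ↦ mul_comm _ _) |>.trans (.of_bound 1 (.of_forall fun t ↦ ?_))
      simp [hcn]
    have h4 := h2.mul h3
    simp only [one_mul] at h4
    exact ((h1.locallyIntegrableOn measurableSet_Ici).integrableOn_of_isBigO_atTop h4
      ⟨Set.Ioi 0, Ioi_mem_atTop 0, exp_neg_integrableOn_Ioi 0 (by positivity)⟩).mono_set
      Set.Ioi_subset_Ici_self
  have := MeasureTheory.integral_Ioi_of_hasDerivAt_of_tendsto'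
    (fun t (ht : τ.im ≤ t) ↦ (hG _ (hcball (τ.im_pos.trans_le ht))).comp_of_eq t (hcd t) rfl) hint
    ((hG 0 h0).continuousAt.tendsto.comp hc0)
  rw [eichler, MeasureTheory.setIntegral_congr_fun measurableSet_Ioi
    fun t ht ↦ hfc t (τ.im_pos.trans ht), this]
  have h5 : (τ.re + τ.im * Complex.I : ℂ) = τ := Complex.re_add_im τ
  simp [hc, h5]

lemma mdifferentiable_eichler {N : ℕ} (f : CuspFormTwo N) : MDiff (eichler f) := by
  obtain ⟨G, hG, h⟩ := eichler_eq_primitive f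
  rw [mdifferentiable_iff]
  have hq : DifferentiableOn ℂ (fun z ↦ G (qParam 1 z) - G 0) {z | 0 < z.im} := by
    refine (hG.comp (differentiable_qParam.differentiableOn) fun z hz ↦ ?_).sub_const _
    simpa using norm_qParam_lt_one one_pos hz
  refine hq.congr fun z hz ↦ ?_
  simp [h, ofComplex_apply_of_im_pos hz]

section

variable {E : WeierstrassCurve ℚ} {Λ : PeriodPair} {N : ℕ} {f : CuspFormTwo N}

lemma eichler_smul_sub_mem (hΛ : (Λ.lattice : Set ℂ) = periods f) {M : SL(2, ℤ)}
    (hM : M ∈ CongruenceSubgroup.Gamma0 N) (τ : ℍ) :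
    eichler f (M • τ) - eichler f τ ∈ Λ.lattice := by
  rw [← SetLike.mem_coe, hΛ]
  exact ⟨M, hM, τ, rfl⟩

/-- A constant integral would have only the period `0`, but `ω₁` is a nonzero period. -/
lemma exists_eichler_ne (hΛ : (Λ.lattice : Set ℂ) = periods f) (c : ℂ) :
    ∃ τ, eichler f τ ≠ c := by
  by_contra! h
  have h1 : Λ.ω₁ ∈ (Λ.lattice : Set ℂ) := Λ.ω₁_mem_lattice
  obtain ⟨M, -, τ, hτ⟩ := hΛ ▸ h1
  refine Λ.indep.ne_zero 0 ?_
  simpa [h] using hτ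

lemma eventually_eichler_notMem (hΛ : (Λ.lattice : Set ℂ) = periods f) (τ₀ : ℍ) :
    ∀ᶠ τ in 𝓝[≠] τ₀, eichler f τ ∉ Λ.lattice := by
  have hc : Tendsto (eichler f) (𝓝[≠] τ₀) (𝓝 (eichler f τ₀)) :=
    ((mdifferentiable_eichler f).continuous.tendsto τ₀).mono_left nhdsWithin_le_nhds
  have h1 := hc (Λ.compl_lattice_sdiff_singleton_mem_nhds (eichler f τ₀))
  have h2 : ∀ᶠ τ in 𝓝[≠] τ₀, eichler f τ ≠ eichler f τ₀ := by
    by_contra h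
    have h3 := eq_zero_of_frequently
      ((mdifferentiable_eichler f).sub (mdifferentiable_const (c := eichler f τ₀))) (τ := τ₀)
      ((not_eventually.mp h).mono fun τ hτ ↦ by simpa [sub_eq_zero] using hτ)
    obtain ⟨τ, hτ⟩ := exists_eichler_ne hΛ (eichler f τ₀)
    exact hτ (sub_eq_zero.mp (congrFun h3 τ))
  filter_upwards [h1, h2] with τ hτ1 hτ2 hτ
  exact hτ1 ⟨hτ, hτ2⟩

lemma xFun_eq_coe_iff {τ : ℍ} {a : ℂ} : xFun E Λ f τ = (a : OnePoint ℂ) ↔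
    eichler f τ ∉ Λ.lattice ∧ Λ.weierstrassP (eichler f τ) - (E.b₂ : ℂ) / 12 = a := by
  unfold xFun
  split_ifs with h
  · simp [h, OnePoint.infty_ne_coe]
  · simp [h]

lemma weierstrassP_eichler_smul (hΛ : (Λ.lattice : Set ℂ) = periods f) {M : SL(2, ℤ)}
    (hM : M ∈ CongruenceSubgroup.Gamma0 N) (τ : ℍ) :
    Λ.weierstrassP (eichler f (M • τ)) = Λ.weierstrassP (eichler f τ) := by
  simpa using Λ.weierstrassP_add_coe (eichler f τ) ⟨_, eichler_smul_sub_mem hΛ hM τ⟩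

lemma eichler_smul_mem_iff (hΛ : (Λ.lattice : Set ℂ) = periods f) {M : SL(2, ℤ)}
    (hM : M ∈ CongruenceSubgroup.Gamma0 N) (τ : ℍ) :
    eichler f (M • τ) ∈ Λ.lattice ↔ eichler f τ ∈ Λ.lattice := by
  simpa using (Λ.lattice.add_mem_iff_right (eichler_smul_sub_mem hΛ hM τ) (y := eichler f τ))

variable (E Λ f) in
open Classical in
/-- The function `1 / (x - α)`, with value `0` at the poles of `x` (and where `x = α`). -/
def invSub (α : ℂ) (τ : ℍ) : ℂ :=
  if eichler f τ ∈ Λ.lattice then 0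
  else (Λ.weierstrassP (eichler f τ) - (E.b₂ : ℂ) / 12 - α)⁻¹

lemma invSub_of_xFun_eq {τ : ℍ} {a : ℂ} (h : xFun E Λ f τ = (a : OnePoint ℂ)) (α : ℂ) :
    invSub E Λ f α τ = (a - α)⁻¹ := by
  obtain ⟨h1, h2⟩ := xFun_eq_coe_iff.mp h
  rw [invSub, if_neg h1, h2]

lemma invSub_smul (hΛ : (Λ.lattice : Set ℂ) = periods f) {M : SL(2, ℤ)}
    (hM : M ∈ CongruenceSubgroup.Gamma0 N) (α : ℂ) (τ : ℍ) :
    invSub E Λ f α (M • τ) = invSub E Λ f α τ := by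
  have h := eichler_smul_mem_iff hΛ hM τ
  by_cases h1 : eichler f τ ∈ Λ.lattice
  · rw [invSub, invSub, if_pos h1, if_pos (h.mpr h1)]
  · rw [invSub, invSub, if_neg h1, if_neg (mt h.mp h1), weierstrassP_eichler_smul hΛ hM]

lemma mdifferentiableAt_weierstrassP_eichler {τ : ℍ} (h : eichler f τ ∉ Λ.lattice) :
    MDiffAt (fun τ ↦ Λ.weierstrassP (eichler f τ)) τ := by
  have h1 : DifferentiableAt ℂ Λ.weierstrassP (eichler f τ) :=
    Λ.differentiableOn_weierstrassP.differentiableAt (Λ.isClosed_lattice.isOpen_compl.mem_nhds h)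
  have h2 := mdifferentiableAt_iff.mp (mdifferentiable_eichler f τ)
  rw [mdifferentiableAt_iff]
  exact DifferentiableAt.comp (g := Λ.weierstrassP) (τ : ℂ) (by simpa using h1) h2

lemma eventually_notMem_of_notMem {τ : ℍ} (h : eichler f τ ∉ Λ.lattice) :
    ∀ᶠ τ' in 𝓝 τ, eichler f τ' ∉ Λ.lattice :=
  (mdifferentiable_eichler f).continuous.continuousAt.eventually
    (Λ.isClosed_lattice.isOpen_compl.mem_nhds h)

lemma mdifferentiableAt_invSub {α : ℂ} {τ : ℍ} (h : eichler f τ ∉ Λ.lattice)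
    (hα : xFun E Λ f τ ≠ (α : OnePoint ℂ)) : MDiffAt (invSub E Λ f α) τ := by
  have hne : Λ.weierstrassP (eichler f τ) - (E.b₂ : ℂ) / 12 - α ≠ 0 := fun h0 ↦
    hα (xFun_eq_coe_iff.mpr ⟨h, sub_eq_zero.mp h0⟩)
  have h1 := mdifferentiableAt_iff.mp (mdifferentiableAt_weierstrassP_eichler h)
  have h2 : MDiffAt (fun τ ↦ (Λ.weierstrassP (eichler f τ) - (E.b₂ : ℂ) / 12 - α)⁻¹) τ := by
    rw [mdifferentiableAt_iff]
    exact ((h1.sub_const _).sub_const _).inv (by simpa using hne)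
  refine h2.congr_of_eventuallyEq ?_
  filter_upwards [eventually_notMem_of_notMem h] with τ' hτ'
  rw [invSub, if_neg hτ']

lemma tendsto_weierstrassP_cobounded (Λ : PeriodPair) {l : ℂ} (hl : l ∈ Λ.lattice) :
    Tendsto Λ.weierstrassP (𝓝[≠] l) (Bornology.cobounded ℂ) := by
  -- The regular part of `℘` at `l`. For `l = 0` the term `1 / l ^ 2` is `0` by convention, as it
  -- should be.
  have h1 : Tendsto (fun z ↦ Λ.weierstrassPExcept l z - 1 / l ^ 2) (𝓝[≠] l)
      (𝓝 (Λ.weierstrassPExcept l l - 1 / l ^ 2)) :=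
    ((Λ.analyticAt_weierstrassPExcept l).continuousAt.tendsto.sub_const _).mono_left
      nhdsWithin_le_nhds
  have h2 : Tendsto (fun z ↦ 1 / (z - l) ^ 2) (𝓝[≠] l) (Bornology.cobounded ℂ) := by
    simp only [one_div]
    refine tendsto_inv₀_nhdsNE_zero.comp (tendsto_nhdsWithin_iff.mpr ⟨?_, ?_⟩)
    · have : Continuous fun z : ℂ ↦ (z - l) ^ 2 := by fun_prop
      simpa using (this.tendsto l).mono_left nhdsWithin_le_nhds
    · filter_upwards [self_mem_nhdsWithin] with z hz
      simpa [sub_eq_zero] using hz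
  rw [← tendsto_norm_atTop_iff_cobounded] at h2 ⊢
  refine tendsto_atTop_mono (fun z ↦ ?_) (h2.atTop_add h1.norm.neg)
  rw [← Λ.weierstrassPExcept_add ⟨l, hl⟩ z, ← sub_eq_add_neg, ← norm_neg (_ - 1 / l ^ 2)]
  refine (norm_sub_norm_le _ _).trans_eq (congrArg norm ?_)
  ring

lemma eventually_norm_weierstrassP_ge (Λ : PeriodPair) {l : ℂ} (hl : l ∈ Λ.lattice) (c : ℂ) :
    ∀ᶠ z in 𝓝 l, z ∉ Λ.lattice → 1 ≤ ‖Λ.weierstrassP z - c‖ := by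
  have h1 := (tendsto_norm_atTop_iff_cobounded.mpr
    (tendsto_weierstrassP_cobounded Λ hl)).eventually_ge_atTop (1 + ‖c‖)
  filter_upwards [eventually_nhdsWithin_iff.mp h1] with z hz hzl
  have h2 := hz fun h ↦ hzl (h ▸ hl)
  linarith [norm_sub_norm_le (Λ.weierstrassP z) c]

/-- Local boundedness is all that removing singularities requires: at a pole of `x`, `℘` is large
and the inverse is at most 1. -/
lemma eventually_norm_invSub_le {α : ℂ} {τ₀ : ℍ} (hα : xFun E Λ f τ₀ ≠ (α : OnePoint ℂ)) :
    ∃ B, ∀ᶠ τ in 𝓝 τ₀, ‖invSub E Λ f α τ‖ ≤ B := by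
  by_cases h : eichler f τ₀ ∈ Λ.lattice
  · refine ⟨1, ?_⟩
    filter_upwards [(mdifferentiable_eichler f).continuous.continuousAt.eventually
      (eventually_norm_weierstrassP_ge Λ h ((E.b₂ : ℂ) / 12 + α))] with τ hτ
    rw [invSub]
    split_ifs with h1
    · simp
    · rw [norm_inv, sub_sub]
      exact inv_le_one_of_one_le₀ (hτ h1)
  · exact ⟨_, (mdifferentiableAt_invSub h hα).continuousAt.norm.eventually_le_const
      (lt_add_one _)⟩

/-- If `x` equals `α` or `∞` everywhere, then it is constant equal to `α`. -/
lemma xFun_eq_const (hΛ : (Λ.lattice : Set ℂ) = periods f) {α : ℂ}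
    (h : ∀ (τ : ℍ) (a : ℂ), xFun E Λ f τ = (a : OnePoint ℂ) → a = α) (τ : ℍ) :
    xFun E Λ f τ = (α : OnePoint ℂ) := by
  have hval (τ' : ℍ) (h' : eichler f τ' ∉ Λ.lattice) :
      Λ.weierstrassP (eichler f τ') - (E.b₂ : ℂ) / 12 = α := h _ _ (xFun_eq_coe_iff.mpr ⟨h', rfl⟩)
  by_cases hτ : eichler f τ ∈ Λ.lattice
  · exfalso
    have h1 := (mdifferentiable_eichler f).continuous.continuousAt.eventually
      (eventually_norm_weierstrassP_ge Λ hτ ((E.b₂ : ℂ) / 12 + α))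
    obtain ⟨τ', h2, h3⟩ := ((h1.filter_mono nhdsWithin_le_nhds).and
      (eventually_eichler_notMem hΛ τ)).exists
    have h4 := h2 h3
    rw [← sub_sub, hval _ h3] at h4
    norm_num at h4
  · exact xFun_eq_coe_iff.mpr ⟨hτ, hval τ hτ⟩

end

/-! ### Removable singularities on the upper half plane -/

/-- Riemann's theorem on removable singularities. Taking the punctured limit at every point gives
one global formula, so no local extensions have to be glued. -/
lemma differentiableAt_limUnder {w : ℂ → ℂ} {c : ℂ}
    (hd : ∀ᶠ z in 𝓝[≠] c, DifferentiableAt ℂ w z)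
    (hb : ∃ B, ∀ᶠ z in 𝓝[≠] c, ‖w z‖ ≤ B) :
    DifferentiableAt ℂ (fun z ↦ limUnder (𝓝[≠] z) w) c := by
  obtain ⟨B, hB⟩ := hb
  obtain ⟨s, hs, hsd⟩ := eventually_iff_exists_mem.mp
    (eventually_nhdsWithin_iff.mp (hd.and hB))
  have h1 := Complex.differentiableOn_update_limUnder_of_bddAbove (f := w) hs
    (fun z hz ↦ (hsd z hz.1 hz.2).1.differentiableWithinAt)
    ⟨B, by rintro _ ⟨z, hz, rfl⟩; exact (hsd z hz.1 hz.2).2⟩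
  refine (h1.differentiableAt hs).congr_of_eventuallyEq ?_
  filter_upwards [hs] with z hz
  rcases eq_or_ne z c with rfl | hzc
  · simp
  · rw [Function.update_of_ne hzc]
    exact ((hsd z hz hzc).1.continuousAt.tendsto.mono_left nhdsWithin_le_nhds).limUnder_eq

lemma eventually_nhdsNE_coe_iff {p : ℂ → Prop} {τ : ℍ} :
    (∀ᶠ z in 𝓝[≠] (τ : ℂ), p z) ↔ ∀ᶠ τ' : ℍ in 𝓝[≠] τ, p τ' := by
  rw [eventually_nhdsWithin_iff, eventually_nhdsWithin_iff, ← isOpenEmbedding_coe.map_nhds_eq,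
    eventually_map]
  simp

lemma exists_mdifferentiable_extension {z : ℍ → ℂ}
    (hd : ∀ τ, ∀ᶠ τ' in 𝓝[≠] τ, MDiffAt z τ')
    (hb : ∀ τ, ∃ B, ∀ᶠ τ' in 𝓝[≠] τ, ‖z τ'‖ ≤ B) :
    ∃ w : ℍ → ℂ, MDiff w ∧ ∀ τ, ∀ᶠ τ' in 𝓝[≠] τ, w τ' = z τ' := by
  set W : ℂ → ℂ := fun c ↦ limUnder (𝓝[≠] c) (z ∘ ofComplex) with hW
  refine ⟨fun τ ↦ W τ, fun τ ↦ ?_, fun τ ↦ ?_⟩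
  · rw [mdifferentiableAt_iff]
    have h1 : DifferentiableAt ℂ W τ := by
      refine differentiableAt_limUnder ?_ ?_
      · rw [eventually_nhdsNE_coe_iff]
        exact (hd τ).mono fun τ' h ↦ mdifferentiableAt_iff.mp h
      · obtain ⟨B, hB⟩ := hb τ
        exact ⟨B, eventually_nhdsNE_coe_iff.mpr (by simpa using hB)⟩
    refine h1.congr_of_eventuallyEq ?_
    filter_upwards [isOpen_upperHalfPlaneSet.mem_nhds τ.im_pos] with c hc
    simp [ofComplex_apply_of_im_pos hc]
  · filter_upwards [hd τ] with τ' h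
    have h1 := (mdifferentiableAt_iff.mp h).continuousAt
    have := (h1.tendsto.mono_left (nhdsWithin_le_nhds (s := {(τ' : ℂ)}ᶜ))).limUnder_eq
    simpa [hW] using this

lemma eq_of_eventually_nhdsNE_eq {u v : ℍ → ℂ} (hu : Continuous u) (hv : Continuous v)
    (h : ∀ τ, ∀ᶠ τ' in 𝓝[≠] τ, u τ' = v τ') : u = v := by
  funext τ
  exact tendsto_nhds_unique_of_eventuallyEq (hu.continuousAt.mono_left nhdsWithin_le_nhds)
    (hv.continuousAt.mono_left nhdsWithin_le_nhds) (h τ)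

/-! ### Integrality over `ℂ[j]` -/

/-- The ring of functions on the upper half plane with at most a pole at `i∞`. -/
def poleAtImInfty : Subring (ℍ → ℂ) where
  carrier := {h | ∃ m : ℕ, IsBoundedAtImInfty fun τ ↦ h τ * Δ τ ^ m}
  mul_mem' := by
    rintro a b ⟨m, hm⟩ ⟨n, hn⟩
    refine ⟨m + n, ?_⟩
    convert! hm.mul hn using 1
    ext τ
    simp only [Pi.mul_apply]
    ring
  one_mem' := ⟨0, by simpa using! const_boundedAtFilter atImInfty (1 : ℂ)⟩
  add_mem' := by
    rintro a b ⟨m, hm⟩ ⟨n, hn⟩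
    have hΔ (k : ℕ) : IsBoundedAtImInfty fun τ ↦ Δ τ ^ k :=
      (Asymptotics.IsBigO.pow discriminant_isZeroAtImInfty.isBoundedAtImInfty k).congr_right
        fun _ ↦ one_pow k
    refine ⟨m + n, ?_⟩
    convert! (hm.mul (hΔ n)).add (hn.mul (hΔ m)) using 1
    ext τ
    simp only [Pi.mul_apply, Pi.add_apply]
    ring
  zero_mem' := ⟨0, by simpa using! const_boundedAtFilter atImInfty (0 : ℂ)⟩
  neg_mem' := by
    rintro a ⟨m, hm⟩
    refine ⟨m, ?_⟩
    convert! hm.neg using 1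
    ext τ
    simp

/-- The ring of holomorphic functions on the upper half plane. -/
def holomorphicRing : Subring (ℍ → ℂ) where
  carrier := {h | MDiff h}
  mul_mem' ha hb := ha.mul hb
  one_mem' := mdifferentiable_const
  add_mem' ha hb := ha.add hb
  zero_mem' := mdifferentiable_const
  neg_mem' ha := ha.neg

lemma const_mem_poleAtImInfty (c : ℂ) : (fun _ ↦ c) ∈ poleAtImInfty :=
  ⟨0, by simpa using! const_boundedAtFilter atImInfty c⟩

lemma mem_poleAtImInfty_of_norm_le {u v : ℍ → ℂ} (hv : v ∈ poleAtImInfty)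
    (h : ∀ᶠ τ in atImInfty, ‖u τ‖ ≤ ‖v τ‖) : u ∈ poleAtImInfty := by
  obtain ⟨m, hm⟩ := hv
  refine ⟨m, Asymptotics.IsBigO.trans (.of_bound 1 ?_) hm⟩
  filter_upwards [h] with τ hτ
  rw [one_mul, norm_mul, norm_mul]
  gcongr

lemma jInv_mem_poleAtImInfty : jInv ∈ poleAtImInfty := by
  refine ⟨1, ?_⟩
  simp only [pow_one, jInv_mul_discriminant]
  exact (tendsto_E₄_atImInfty.pow 3).isBigO_one ℝ

lemma eval_jInv_mem_poleAtImInfty (p : ℂ[X]) : (fun τ ↦ p.eval (jInv τ)) ∈ poleAtImInfty := by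
  have : (fun τ ↦ p.eval (jInv τ)) =
      ∑ i ∈ Finset.range (p.natDegree + 1), (fun _ ↦ p.coeff i) * jInv ^ i := by
    ext τ
    simp [eval_eq_sum_range]
  rw [this]
  exact sum_mem fun i _ ↦ mul_mem (const_mem_poleAtImInfty _) (pow_mem jInv_mem_poleAtImInfty i)

lemma mdifferentiable_eval_jInv (p : ℂ[X]) : MDiff fun τ ↦ p.eval (jInv τ) := by
  intro τ
  rw [mdifferentiableAt_iff]
  exact p.differentiableAt.comp (τ : ℂ) (mdifferentiableAt_iff.mp (mdifferentiable_jInv τ))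

lemma aeval_jInv_apply (p : ℂ[X]) (τ : ℍ) : aeval jInv p τ = p.eval (jInv τ) := by
  simp

/-- A function invariant under a finite index subgroup, all of whose conjugates are holomorphic
on `ℍ` and have at most a pole at `i∞`, is integral over `ℂ[j]`. -/
lemma exists_monic_aeval_eq_zero (Γ : Subgroup SL(2, ℤ)) [Γ.FiniteIndex] {z : ℍ → ℂ}
    (hz : ∀ g : SL(2, ℤ), (fun τ ↦ z (g • τ)) ∈ (holomorphicRing ⊓ poleAtImInfty))
    (hinv : ∀ g ∈ Γ, ∀ τ, z (g • τ) = z τ) :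
    ∃ R : ℂ[X][X], R.Monic ∧ R.eval₂ (aeval jInv : ℂ[X] →ₐ[ℂ] (ℍ → ℂ)).toRingHom z = 0 := by
  classical
  have := Γ.fintypeQuotientOfFiniteIndex
  -- The inverse makes the conjugate depend only on the left coset `gΓ`.
  let Z : SL(2, ℤ) ⧸ Γ → ℍ → ℂ := Quotient.lift (fun g τ ↦ z (g⁻¹ • τ)) fun a b hab ↦ by
    funext τ
    have h1 := hinv _ (QuotientGroup.leftRel_apply.mp hab) (b⁻¹ • τ)
    rw [smul_smul] at h1
    simpa using h1
  have hZmk (g : SL(2, ℤ)) : Z g = fun τ ↦ z (g⁻¹ • τ) := rfl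
  have hZmem (q) : Z q ∈ (holomorphicRing ⊓ poleAtImInfty) := by
    induction q using QuotientGroup.induction_on with
    | H g => exact hz g⁻¹
  have hZsmul (g : SL(2, ℤ)) (q) (τ : ℍ) : Z q (g • τ) = Z (g⁻¹ • q) τ := by
    induction q using QuotientGroup.induction_on with
    | H a =>
      rw [hZmk, MulAction.Quotient.smul_coe, hZmk]
      simp [smul_smul]
  set P : (ℍ → ℂ)[X] := ∏ q, (X - C (Z q)) with hP
  have hPmonic : P.Monic := monic_prod_of_monic _ _ fun q _ ↦ monic_X_sub_C _
  have hPmem (k : ℕ) : P.coeff k ∈ (holomorphicRing ⊓ poleAtImInfty) := by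
    have : P = (∏ q, (X - C (⟨Z q, hZmem q⟩ : ↥(holomorphicRing ⊓ poleAtImInfty)))).map
        (holomorphicRing ⊓ poleAtImInfty).subtype := by
      simp [hP, Polynomial.map_prod]
    rw [this, coeff_map]
    exact Subtype.property _
  -- Translating `τ` by `g` permutes the cosets, hence the roots of `P`.
  have hPinv (g : SL(2, ℤ)) (k : ℕ) (τ : ℍ) : P.coeff k (g • τ) = P.coeff k τ := by
    let ev (τ : ℍ) : (ℍ → ℂ) →+* ℂ := Pi.evalRingHom (fun _ ↦ ℂ) τ
    have h1 : P.map (ev (g • τ)) = P.map (ev τ) := by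
      simp only [hP, Polynomial.map_prod, Polynomial.map_sub, map_X, map_C, ev,
        Pi.evalRingHom_apply, hZsmul]
      exact Fintype.prod_equiv (MulAction.toPerm g⁻¹) _ _ fun q ↦ rfl
    simpa [ev] using congrArg (fun p ↦ p.coeff k) h1
  have hlift : P ∈ lifts (aeval jInv : ℂ[X] →ₐ[ℂ] (ℍ → ℂ)).toRingHom := by
    rw [lifts_iff_coeff_lifts]
    intro k
    obtain ⟨hd, m, hb⟩ := hPmem k
    obtain ⟨p, hp⟩ := exists_polynomial_jInv hd (hPinv · k) hb
    refine ⟨p, funext fun τ ↦ ?_⟩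
    rw [hp]
    exact aeval_jInv_apply p τ
  obtain ⟨R, hR, -, hRm⟩ := lifts_and_degree_eq_and_monic hlift hPmonic
  refine ⟨R, hRm, ?_⟩
  have hz1 : Z (1 : SL(2, ℤ)) = z := by simp [hZmk]
  rw [← eval_map, hR, hP, eval_prod, ← hz1]
  exact Finset.prod_eq_zero (Finset.mem_univ ((1 : SL(2, ℤ)) : SL(2, ℤ) ⧸ Γ)) (by simp)

/-! ### The polynomial `F` over `ℂ[j]` -/

lemma exists_not_isUnit_dvd_of_isAlgebraic {β : ℂ} (hβ : IsAlgebraic ℚ β) :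
    ∃ P : ℤ[X], ¬ IsUnit P ∧ ∀ q : ℤ[X], aeval β q = 0 → P ∣ q := by
  obtain ⟨b, hb, hP⟩ := IsLocalization.integerNormalization_spec (nonZeroDivisors ℤ) (minpoly ℚ β)
  set P₀ := IsLocalization.integerNormalization (nonZeroDivisors ℤ) (minpoly ℚ β)
  have hb0 : (b : ℚ) ≠ 0 := by exact_mod_cast nonZeroDivisors.ne_zero hb
  have hmap : P₀.map (algebraMap ℤ ℚ) = C (b : ℚ) * minpoly ℚ β := by
    rw [hP, zsmul_eq_mul, C_eq_intCast]
  refine ⟨P₀.primPart, fun hu ↦ ?_, fun q hq ↦ ?_⟩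
  · have h1 := P₀.natDegree_primPart
    rw [natDegree_eq_zero_of_isUnit hu, ← natDegree_map_eq_of_injective
      (f := algebraMap ℤ ℚ) Int.cast_injective, hmap, natDegree_C_mul hb0] at h1
    exact (minpoly.natDegree_pos hβ.isIntegral).ne h1
  · refine IsPrimitive.dvd_of_fraction_map_dvd_fraction_map (K := ℚ)
      P₀.isPrimitive_primPart ?_
    have h1 : minpoly ℚ β ∣ q.map (algebraMap ℤ ℚ) := minpoly.dvd _ _ (by rwa [aeval_map_algebraMap])
    refine (Polynomial.map_dvd _ P₀.primPart_dvd).trans ?_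
    rw [hmap]
    exact (isUnit_C.mpr hb0.isUnit).mul_left_dvd.mpr h1

lemma evalXJ_eq_evalEval (F : ℤ[X][X]) (α β : ℂ) :
    evalXJ F α β = (F.map (mapRingHom (Int.castRingHom ℂ))).evalEval β α := by
  rw [← eval₂_evalRingHom, eval₂_map, evalXJ]
  congr 1
  ext <;> simp

variable {x : ℍ → OnePoint ℂ} {F : ℤ[X][X]}

/-- A nonunit common factor over `ℂ` has a root `β`, which is algebraic because some coefficient of
`F` is nonzero. The primitive integral multiple of its minimal polynomial then divides every
coefficient already in `ℤ[j]`. -/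
lemma IsModularPolynomial.isPrimitive_map (hF : IsModularPolynomial x F) :
    (F.map (mapRingHom (Int.castRingHom ℂ))).IsPrimitive := by
  have hF0 : F ≠ 0 := by
    rintro rfl
    exact hF.irreducible.ne_zero (by simp)
  have hinj : Function.Injective (mapRingHom (Int.castRingHom ℂ)) :=
    map_injective _ Int.cast_injective
  intro r hr
  by_contra hu
  have hr0 : r ≠ 0 := by
    rintro rfl
    rw [C_0, zero_dvd_iff] at hr
    exact hF0 ((Polynomial.map_eq_zero_iff hinj).mp hr)
  obtain ⟨β, hβ⟩ := IsAlgClosed.exists_root r fun h ↦ hu (isUnit_iff_degree_eq_zero.mpr h)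
  have hroot (k : ℕ) : aeval β (F.coeff k) = 0 := by
    obtain ⟨s, hs⟩ := (C_dvd_iff_dvd_coeff _ _).mp hr k
    have := congrArg (eval β) hs
    rw [eval_mul, hβ.eq_zero, zero_mul, coeff_map] at this
    simpa [eval_map, aeval_def] using this
  obtain ⟨k, hk⟩ : ∃ k, F.coeff k ≠ 0 := by
    by_contra! h
    exact hF0 (Polynomial.ext (by simpa using h))
  have hint : IsAlgebraic ℚ β := by
    have : IsAlgebraic ℤ β := ⟨_, hk, hroot k⟩
    exact (IsFractionRing.isAlgebraic_iff ℤ ℚ ℂ).mp this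
  obtain ⟨P, hP, hdvd⟩ := exists_not_isUnit_dvd_of_isAlgebraic hint
  refine hP (hF.primitive P ?_)
  rw [C_dvd_iff_dvd_coeff]
  exact fun k ↦ hdvd _ (hroot k)

lemma evalEval_eq_zero_of_eq (hF : IsModularPolynomial x F) {τ : ℍ} {a : ℂ} (h : x τ = a) :
    (F.map (mapRingHom (Int.castRingHom ℂ))).evalEval (jInv τ) a = 0 :=
  evalXJ_eq_evalEval F a _ ▸ hF.vanishes τ a h

lemma map_algebraMap_eq_map_intPolyToRatFunc (F : ℤ[X][X]) :
    (F.map (mapRingHom (Int.castRingHom ℂ))).map (algebraMap ℂ[X] (RatFunc ℂ)) =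
      F.map intPolyToRatFunc := by
  rw [Polynomial.map_map, intPolyToRatFunc]

/-- `F` generates the ideal of polynomial relations between `x` and `j`. -/
lemma IsModularPolynomial.dvd_of_frequently (hF : IsModularPolynomial x F) {P : ℂ[X][X]} {τ₀ : ℍ}
    (h : ∃ᶠ τ in 𝓝[≠] τ₀, ∃ a : ℂ, x τ = a ∧ P.evalEval (jInv τ) a = 0) :
    F.map (mapRingHom (Int.castRingHom ℂ)) ∣ P := by
  set Q := F.map (mapRingHom (Int.castRingHom ℂ)) with hQ
  refine IsPrimitive.dvd_of_fraction_map_dvd_fraction_map (K := RatFunc ℂ) hF.isPrimitive_map ?_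
  by_contra hnd
  have hirr : Irreducible (Q.map (algebraMap ℂ[X] (RatFunc ℂ))) := by
    rw [hQ, map_algebraMap_eq_map_intPolyToRatFunc]
    exact hF.irreducible
  -- Bézout over `ℂ(j)`, with denominators `b`, `c` cleared: at the common zeros `(bc)(j)` vanishes,
  -- and these accumulate at `τ₀`.
  obtain ⟨u, v, huv⟩ := hirr.coprime_iff_not_dvd.mpr hnd
  obtain ⟨b, hb, hu⟩ := IsLocalization.integerNormalization_spec (nonZeroDivisors ℂ[X]) u
  obtain ⟨c, hc, hv⟩ := IsLocalization.integerNormalization_spec (nonZeroDivisors ℂ[X]) v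
  set u' := IsLocalization.integerNormalization (nonZeroDivisors ℂ[X]) u
  set v' := IsLocalization.integerNormalization (nonZeroDivisors ℂ[X]) v
  have hid : C c * u' * Q + C b * v' * P = C (b * c) := by
    apply map_injective (algebraMap ℂ[X] (RatFunc ℂ)) (RatFunc.algebraMap_injective ℂ)
    simp only [Polynomial.map_add, Polynomial.map_mul, hu, hv, map_C, Algebra.smul_def,
      Polynomial.algebraMap_apply, map_mul]
    linear_combination (C (algebraMap ℂ[X] (RatFunc ℂ) b) * C (algebraMap ℂ[X] (RatFunc ℂ) c))
      * huv
  have hz := eq_zero_of_frequently (mdifferentiable_eval_jInv (b * c)) (τ := τ₀) <| h.mono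
    fun τ ⟨a, ha, hP⟩ ↦ by
      have h1 := congrArg (evalEval (jInv τ) a) hid
      rw [evalEval_add, evalEval_mul, evalEval_mul _ _ _ P, evalEval_eq_zero_of_eq hF ha, hP,
        evalEval_C] at h1
      simpa using h1.symm
  have := polynomial_eq_zero_of_eventually (p := b * c) (.of_forall fun τ ↦ congrFun hz τ)
  exact mul_ne_zero (nonZeroDivisors.ne_zero hb) (nonZeroDivisors.ne_zero hc) this

lemma IsModularPolynomial.dvd_X_sub_C (hF : IsModularPolynomial x F) {α : ℂ[X]}
    (hα : (F.map (mapRingHom (Int.castRingHom ℂ))).eval α = 0) :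
    F.map (mapRingHom (Int.castRingHom ℂ)) ∣ X - C α := by
  refine IsPrimitive.dvd_of_fraction_map_dvd_fraction_map (K := RatFunc ℂ) hF.isPrimitive_map ?_
  have h1 := Polynomial.map_dvd (algebraMap ℂ[X] (RatFunc ℂ)) (dvd_iff_isRoot.mpr hα)
  rw [map_algebraMap_eq_map_intPolyToRatFunc] at h1 ⊢
  refine Irreducible.dvd_symm ?_ hF.irreducible h1
  rw [Polynomial.map_sub, map_X, map_C]
  exact irreducible_X_sub_C _

/-! ### Points of the curve `F = 0` come from the upper half plane -/

/-- For `0 < ‖t‖ ≤ 1`, divide `p(t) = 0` by `t` and bound the remaining powers of `t` by 1; for `‖t‖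
≥ 1` the term `‖p.coeff 0‖` suffices. At `t = 0` the inverse is `0` by convention. -/
lemma norm_coeff_zero_mul_norm_inv_le {p : ℂ[X]} {n : ℕ} (hn : p.natDegree ≤ n) {t : ℂ}
    (ht : p.eval t = 0) :
    ‖p.coeff 0‖ * ‖t⁻¹‖ ≤ ∑ i ∈ Finset.range (n + 1), ‖p.coeff i‖ := by
  rcases eq_or_ne t 0 with rfl | ht0
  · simpa using Finset.sum_nonneg fun i _ ↦ norm_nonneg (p.coeff i)
  rw [Finset.sum_range_succ']
  rcases le_total 1 ‖t‖ with h1 | h1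
  · have h2 : ‖t⁻¹‖ ≤ 1 := by
      rw [norm_inv]
      exact inv_le_one_of_one_le₀ h1
    have h3 : 0 ≤ ∑ i ∈ Finset.range n, ‖p.coeff (i + 1)‖ := by positivity
    nlinarith [norm_nonneg (p.coeff 0)]
  · rw [eval_eq_sum_range' (Nat.lt_succ_of_le hn), Finset.sum_range_succ'] at ht
    have h2 : p.coeff 0 * t⁻¹ = -∑ i ∈ Finset.range n, p.coeff (i + 1) * t ^ i := by
      rw [← div_eq_mul_inv, div_eq_iff ht0, neg_mul, Finset.sum_mul, eq_neg_iff_add_eq_zero, ← ht,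
        add_comm]
      simp [pow_succ, mul_assoc]
    rw [← norm_mul, h2, norm_neg]
    refine (norm_sum_le _ _).trans (le_add_of_le_of_nonneg (Finset.sum_le_sum fun i _ ↦ ?_)
      (norm_nonneg _))
    rw [norm_mul, norm_pow]
    exact mul_le_of_le_one_right (norm_nonneg _) (pow_le_one₀ (norm_nonneg _) h1)

/-- Expanding at `α` in the outer variable makes `a - α` a root, so the bound does not involve `a`.
-/
lemma norm_eval_mul_norm_inv_sub_le (Q : ℂ[X][X]) {α β a : ℂ} (h : Q.evalEval β a = 0) :
    ‖Q.evalEval β α‖ * ‖(a - α)⁻¹‖ ≤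
      ∑ i ∈ Finset.range (Q.natDegree + 1), ‖((taylor (C α) Q).coeff i).eval β‖ := by
  set p := taylor α (Q.map (evalRingHom β)) with hp
  have hpc (i : ℕ) : ((taylor (C α) Q).coeff i).eval β = p.coeff i := by
    rw [← coe_evalRingHom, ← coeff_map, hp]
    simp [taylor_apply, Polynomial.map_comp]
  have hev (b : ℂ) : Q.evalEval β b = (Q.map (evalRingHom β)).eval b := by
    rw [← eval₂_evalRingHom, eval_map]
  have h0 : p.coeff 0 = Q.evalEval β α := by rw [hp, taylor_coeff_zero, hev]
  simp only [hpc, ← h0]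
  refine norm_coeff_zero_mul_norm_inv_le ?_ ?_
  · rw [hp, natDegree_taylor]
    exact natDegree_map_le
  · rw [hp, taylor_eval, sub_add_cancel, ← hev, h]

lemma eventually_eval_jInv_ne_zero {p : ℂ[X]} (hp : p ≠ 0) (τ₀ : ℍ) :
    ∀ᶠ τ in 𝓝[≠] τ₀, p.eval (jInv τ) ≠ 0 := by
  by_contra h
  have hz := eq_zero_of_frequently (mdifferentiable_eval_jInv p) (τ := τ₀)
    ((not_eventually.mp h).mono fun τ ↦ not_not.mp)
  exact hp (polynomial_eq_zero_of_eventually (.of_forall fun τ ↦ congrFun hz τ))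

/-- The homogenization `(X - α) ^ n * R (a / (X - α))` of a bivariate polynomial `R` of degree `n`
in its outer variable. -/
def homogenizeSub (R : ℂ[X][X]) (a : ℂ[X]) (α : ℂ) : ℂ[X][X] :=
  ∑ k ∈ Finset.range (R.natDegree + 1),
    C (R.coeff k * a ^ k) * (X - C (C α)) ^ (R.natDegree - k)

/-- At `X = α` only the top term `k = n` survives, and its coefficient is 1: this is where monicity,
i.e. integrality, enters. -/
lemma evalEval_homogenizeSub_self {R : ℂ[X][X]} (hR : R.Monic) (a : ℂ[X]) (α β : ℂ) :
    (homogenizeSub R a α).evalEval β α = a.eval β ^ R.natDegree := by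
  rw [homogenizeSub, evalEval_finsetSum, Finset.sum_range_succ, Finset.sum_eq_zero]
  · simp [evalEval, hR.coeff_natDegree]
  · intro k hk
    have : R.natDegree - k ≠ 0 := by
      have := Finset.mem_range.mp hk
      omega
    simp [evalEval, this]

lemma evalEval_homogenizeSub (R : ℂ[X][X]) (a : ℂ[X]) {α β b : ℂ} (hb : b ≠ α) :
    (homogenizeSub R a α).evalEval β b =
      (b - α) ^ R.natDegree * R.evalEval β (a.eval β * (b - α)⁻¹) := by
  have hb' := sub_ne_zero.mpr hb
  have hR (t : ℂ) : R.evalEval β t =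
      ∑ k ∈ Finset.range (R.natDegree + 1), (R.coeff k).eval β * t ^ k := by
    rw [← eval₂_evalRingHom, eval₂_eq_sum_range]
    rfl
  rw [homogenizeSub, evalEval_finsetSum, hR, Finset.mul_sum]
  refine Finset.sum_congr rfl fun k hk ↦ ?_
  have hk' : k ≤ R.natDegree := Nat.lt_succ_iff.mp (Finset.mem_range.mp hk)
  conv_rhs => rw [← Nat.sub_add_cancel hk', pow_add]
  simp only [evalEval_mul, evalEval_C, evalEval_pow, evalEval_sub, evalEval_X, eval_mul, eval_pow,
    eval_C, mul_pow, inv_pow]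
  field_simp

section

variable {E : WeierstrassCurve ℚ} {Λ : PeriodPair} {N : ℕ} {f : CuspFormTwo N} {F : ℤ[X][X]}

/-- If `x` does not take the value `α` above `j = β` and `F(α, j) = (j - β)ᵐ a(j)`, then
`a(j) / (x - α)` extends to a function on `ℍ` which is integral over `ℂ[j]`. -/
lemma exists_integral_extension [NeZero N] (hΛ : (Λ.lattice : Set ℂ) = periods f)
    (hF : IsModularPolynomial (xFun E Λ f) F) {α β : ℂ}
    (hne : ∀ τ, jInv τ = β → xFun E Λ f τ ≠ (α : OnePoint ℂ)) {a : ℂ[X]} (ha : a ≠ 0) {m : ℕ}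
    (hm : (F.map (mapRingHom (Int.castRingHom ℂ))).eval (C α) = (X - C β) ^ m * a) :
    ∃ R : ℂ[X][X], R.Monic ∧ ∀ τ₀, ∀ᶠ τ in 𝓝[≠] τ₀,
      R.evalEval (jInv τ) (a.eval (jInv τ) * invSub E Λ f α τ) = 0 := by
  set Q := F.map (mapRingHom (Int.castRingHom ℂ)) with hQ
  set z : ℍ → ℂ := fun τ ↦ a.eval (jInv τ) * invSub E Λ f α τ with hz
  -- `B` depends on `τ` only through `j`, so a bound by `B` passes to all `SL(2, ℤ)`-translates.
  set B : ℍ → ℝ := fun τ ↦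
    ∑ i ∈ Finset.range (Q.natDegree + 1), ‖((taylor (C α) Q).coeff i).eval (jInv τ)‖ with hB
  have hBc : Continuous B := continuous_finsetSum _ fun i _ ↦
    (mdifferentiable_eval_jInv _).continuous.norm
  have hB0 (τ) : 0 ≤ B τ := by positivity
  have hQα (τ : ℍ) : Q.evalEval (jInv τ) α = (jInv τ - β) ^ m * a.eval (jInv τ) := by
    simp [evalEval, hm]
  have hzB (τ : ℍ) : ‖jInv τ - β‖ ^ m * ‖z τ‖ ≤ B τ := by
    by_cases h : eichler f τ ∈ Λ.lattice
    · simpa [hz, invSub, h] using hB0 τ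
    · have hx : xFun E Λ f τ = _ := xFun_eq_coe_iff.mpr ⟨h, rfl⟩
      have h1 := norm_eval_mul_norm_inv_sub_le Q (α := α) (evalEval_eq_zero_of_eq hF hx)
      rw [hQα] at h1
      simpa [hz, invSub_of_xFun_eq hx, mul_assoc] using h1
  have hzd (τ₀ : ℍ) : ∀ᶠ τ in 𝓝[≠] τ₀, MDiffAt z τ := by
    have h0 : (X - C β) ^ m * a ≠ 0 := mul_ne_zero (pow_ne_zero _ (X_sub_C_ne_zero β)) ha
    filter_upwards [eventually_eichler_notMem hΛ τ₀, eventually_eval_jInv_ne_zero h0 τ₀]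
      with τ h1 h2
    refine (mdifferentiable_eval_jInv a τ).mul (mdifferentiableAt_invSub h1 fun hx ↦ h2 ?_)
    rw [← hm]
    exact evalEval_eq_zero_of_eq hF hx
  have hzb (τ₀ : ℍ) : ∃ K, ∀ᶠ τ in 𝓝[≠] τ₀, ‖z τ‖ ≤ K := by
    by_cases hj : jInv τ₀ = β
    · obtain ⟨K, hK⟩ := eventually_norm_invSub_le (hne τ₀ hj)
      have h1 := (mdifferentiable_eval_jInv a).continuous.norm.continuousAt (x := τ₀)
        |>.eventually_le_const (lt_add_one _)
      refine ⟨(‖a.eval (jInv τ₀)‖ + 1) * K, ((hK.and h1).filter_mono nhdsWithin_le_nhds).mono ?_⟩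
      rintro τ ⟨h2, h3⟩
      rw [hz, norm_mul]
      gcongr
    · have hpos : 0 < ‖jInv τ₀ - β‖ ^ m := by
        have := sub_ne_zero.mpr hj
        positivity
      have hjc : Continuous fun τ ↦ ‖jInv τ - β‖ ^ m :=
        ((mdifferentiable_jInv.continuous.sub continuous_const).norm.pow m)
      have h1 := (hBc.continuousAt.div hjc.continuousAt hpos.ne').eventually_le_const
        (lt_add_one (B τ₀ / ‖jInv τ₀ - β‖ ^ m))
      have h2 := hjc.continuousAt.eventually_const_lt hpos
      refine ⟨B τ₀ / ‖jInv τ₀ - β‖ ^ m + 1, ((h1.and h2).filter_mono nhdsWithin_le_nhds).mono ?_⟩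
      rintro τ ⟨h3, h4⟩
      exact ((le_div_iff₀' h4).mpr (hzB τ)).trans h3
  obtain ⟨w, hw, hwz⟩ := exists_mdifferentiable_extension hzd hzb
  have hwB (τ : ℍ) : ‖jInv τ - β‖ ^ m * ‖w τ‖ ≤ B τ := by
    have h1 : Continuous fun τ ↦ ‖jInv τ - β‖ ^ m * ‖w τ‖ :=
      ((mdifferentiable_jInv.continuous.sub continuous_const).norm.pow m).mul hw.continuous.norm
    refine le_of_tendsto_of_tendsto (b := 𝓝[≠] τ)
      (h1.continuousAt.mono_left nhdsWithin_le_nhds)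
      (hBc.continuousAt.mono_left nhdsWithin_le_nhds) ?_
    filter_upwards [hwz τ] with τ' h
    rw [h]
    exact hzB τ'
  have hsmul (g : SL(2, ℤ)) : MDiff fun τ : ℍ ↦ g • τ :=
    mdifferentiable_smul (g := Matrix.SpecialLinearGroup.mapGL ℝ g) (by simp)
  have hmem (g : SL(2, ℤ)) : (fun τ ↦ w (g • τ)) ∈ holomorphicRing ⊓ poleAtImInfty := by
    refine ⟨hw.comp (hsmul g), mem_poleAtImInfty_of_norm_le (v := fun τ ↦ (B τ : ℂ)) ?_ ?_⟩
    · have : (fun τ ↦ (B τ : ℂ)) = ∑ i ∈ Finset.range (Q.natDegree + 1),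
          fun τ ↦ ((‖((taylor (C α) Q).coeff i).eval (jInv τ)‖ : ℝ) : ℂ) := by
        ext τ
        simp [hB]
      rw [this]
      exact sum_mem fun i _ ↦ mem_poleAtImInfty_of_norm_le
        (eval_jInv_mem_poleAtImInfty ((taylor (C α) Q).coeff i)) (.of_forall fun τ ↦ by simp)
    · filter_upwards [tendsto_norm_jInv_atTop.eventually_ge_atTop (1 + ‖β‖)] with τ hτ
      have h1 := hwB (g • τ)
      simp only [hB, jInv_smul] at h1
      have h2 : 1 ≤ ‖jInv τ - β‖ ^ m :=
        one_le_pow₀ (by linarith [norm_sub_norm_le (jInv τ) β])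
      rw [Complex.norm_of_nonneg (hB0 τ)]
      exact (le_mul_of_one_le_left (norm_nonneg _) h2).trans h1
  -- Extending can change values at exceptional points, so invariance is checked on punctured
  -- neighbourhoods and spread by continuity.
  have hinv (g : SL(2, ℤ)) (hg : g ∈ CongruenceSubgroup.Gamma0 N) (τ : ℍ) : w (g • τ) = w τ := by
    refine congrFun (eq_of_eventually_nhdsNE_eq (hw.continuous.comp (hsmul g).continuous)
      hw.continuous fun τ₀ ↦ ?_) τ
    have h1 : Tendsto (fun τ : ℍ ↦ g • τ) (𝓝[≠] τ₀) (𝓝[≠] (g • τ₀)) :=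
      tendsto_nhdsWithin_iff.mpr
        ⟨(hsmul g).continuous.continuousAt.tendsto.mono_left nhdsWithin_le_nhds,
          eventually_mem_nhdsWithin.mono fun τ h ↦ (MulAction.injective g).ne h⟩
    filter_upwards [hwz τ₀, h1.eventually (hwz (g • τ₀))] with τ h2 h3
    simp only [Function.comp_apply]
    rw [h2, h3]
    simp only [hz, jInv_smul, invSub_smul hΛ hg]
  obtain ⟨R, hR, hRw⟩ := exists_monic_aeval_eq_zero (CongruenceSubgroup.Gamma0 N) hmem hinv
  refine ⟨R, hR, fun τ₀ ↦ (hwz τ₀).mono fun τ h ↦ ?_⟩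
  change R.evalEval (jInv τ) (z τ) = 0
  rw [← h, ← eval₂_evalRingHom]
  have h1 := congrArg (Pi.evalRingHom (fun _ : ℍ ↦ ℂ) τ) hRw
  rw [hom_eval₂] at h1
  convert! h1 using 2
  ext <;> simp

end

end ModularParam

/-! ### The contradiction at the point `(α, β)` -/

theorem proposition3p1 (E : WeierstrassCurve ℚ) [E.IsElliptic] (N : ℕ) [NeZero N]
    (f : ModularParam.CuspFormTwo N) (Λ : PeriodPair)
    (hΛ : (Λ.lattice : Set ℂ) = ModularParam.periods f)
    (hE : ModularParam.IsPeriodLattice E Λ)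
    (F : Polynomial (Polynomial ℤ))
    (hF : ModularParam.IsModularPolynomial (ModularParam.xFun E Λ f) F)
    (α β : ℂ) (h : ModularParam.evalXJ F α β = 0) :
    ∃ τ : UpperHalfPlane,
      ModularParam.xFun E Λ f τ = (α : OnePoint ℂ) ∧ ModularParam.jInv τ = β := by
  open ModularParam Topology in
  by_contra! hno
  have hne (τ : ℍ) (hτ : jInv τ = β) : xFun E Λ f τ ≠ (α : OnePoint ℂ) := fun hx ↦ hno τ hx hτ
  set Q := F.map (mapRingHom (Int.castRingHom ℂ)) with hQ
  obtain ⟨τ₀, hτ₀⟩ := jInv_surjective β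
  have hQ0 : Q.eval (C α) ≠ 0 := by
    intro h0
    have hQx (τ : ℍ) (a : ℂ) (hx : xFun E Λ f τ = (a : OnePoint ℂ)) : a = α := by
      have := evalEval_dvd (jInv τ) a (hF.dvd_X_sub_C h0)
      rw [evalEval_eq_zero_of_eq hF hx, zero_dvd_iff] at this
      simpa [sub_eq_zero] using this
    exact hne τ₀ hτ₀ (xFun_eq_const hΛ hQx τ₀)
  -- Removing the full power of `j - β` gives `a(β) ≠ 0`.
  obtain ⟨a, ha, hdvd⟩ := exists_eq_pow_rootMultiplicity_mul_and_not_dvd _ hQ0 β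
  have ha0 : a.eval β ≠ 0 := fun h0 ↦ hdvd (dvd_iff_isRoot.mpr h0)
  obtain ⟨R, hR, hRz⟩ := exists_integral_extension hΛ hF hne (by rintro rfl; simp at ha0) ha
  have hQP : Q ∣ homogenizeSub R a α := by
    refine hF.dvd_of_frequently (τ₀ := τ₀) (Filter.Eventually.frequently ?_)
    filter_upwards [eventually_eichler_notMem hΛ τ₀, eventually_eval_jInv_ne_zero hQ0 τ₀, hRz τ₀]
      with τ h1 h2 h3
    have hx : xFun E Λ f τ = _ := xFun_eq_coe_iff.mpr ⟨h1, rfl⟩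
    refine ⟨_, hx, ?_⟩
    rw [invSub_of_xFun_eq hx] at h3
    rw [evalEval_homogenizeSub, h3, mul_zero]
    rintro rfl
    exact h2 (evalEval_eq_zero_of_eq hF hx)
  have h1 := evalEval_dvd β α hQP
  rw [← evalXJ_eq_evalEval, h, zero_dvd_iff, evalEval_homogenizeSub_self hR] at h1
  exact pow_ne_zero _ ha0 h1

end
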